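/- For $\lambda>0$ set $$\alpha_\lambda=\tfrac12\sqrt{|\lambda^{-1}-1|\,\lambda^{-1}},\qquad \beta_\lambda=\tfrac12\sqrt{|1-\lambda|},\qquad \varepsilon_\lambda=\begin{cases}1&\text{if }\lambda\le 1,\\-1&\text{if }\lambda>1.\end{cases}$$ For $a\in\mathbb{R}$ let $e^{iax^2}$ denote the operator of multiplication by the function $x\mapsto e^{iax^2}$ on $L^2(\mathbb{R})=L^2(\mathbb{R};\mathbb{C})$, and for $s\in\mathbb{R}$ let $e^{is\partial_x^2}$ denote the Schrödinger propagator on $L^2(\mathbb{R})$, i.e. the Fourier multiplier with symbol $e^{-is\xi^2}$ (for the Fourier transform in which $-i\partial_x$ corresponds to multiplication by $\xi$). Then for every $\lambda>0$ and every $u\in L^2(\mathbb{R})$, $$u(\lambda\,\cdot)=\lambda^{-1/2}\,e^{-i\varepsilon_\lambda\alpha_\lambda\partial_x^2}\,e^{-i\beta_\lambda x^2}\,e^{i\varepsilon_\lambda\beta_\lambda\partial_x^2}\,e^{i\alpha_\lambda x^2}\,u$$ as elements of $L^2(\mathbb{R})$ (i.e. almost everywhere). -/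

import Mathlib

open MeasureTheory
open scoped FourierTransform

noncomputable section

/-- The Hilbert space `L²(ℝ)` of complex-valued functions, for Lebesgue measure. -/
abbrev L2R : Type := Lp ℂ 2 (volume : Measure ℝ)

/-- Multiplying an `L²` function by the unimodular function `x ↦ exp(i a x²)` gives an `L²`
function. -/
theorem memLp_expISq_mul (a : ℝ) (u : L2R) :
    MemLp (fun x : ℝ => Complex.exp (Complex.I * (a : ℂ) * (x : ℂ) ^ 2) * u x) 2 volume := by
  refine (Lp.memLp u).of_le ?_ (Filter.Eventually.of_forall fun x => ?_)
  · exact (Continuous.aestronglyMeasurable (by fun_prop)).mul (Lp.aestronglyMeasurable u)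
  · have h : Complex.I * (a : ℂ) * (x : ℂ) ^ 2 = ((a * x ^ 2 : ℝ) : ℂ) * Complex.I := by
      push_cast; ring
    rw [norm_mul, h, Complex.norm_exp_ofReal_mul_I, one_mul]

/-- The operator `e^{i a x²}` on `L²(ℝ)`: multiplication by `x ↦ exp(i a x²)`. -/
def expIXSq (a : ℝ) (u : L2R) : L2R :=
  (memLp_expISq_mul a u).toLp
    (fun x : ℝ => Complex.exp (Complex.I * (a : ℂ) * (x : ℂ) ^ 2) * u x)

/-- The operator `e^{i s ∂ₓ²}` on `L²(ℝ)`, i.e. the Schrödinger propagator: the Fourier multiplier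
with symbol `exp(-i s (2πξ)²)`. Mathlib's Fourier transform has the kernel `exp(-2πi x ξ)`,
so that `∂ₓ²` is the Fourier multiplier with symbol `(2πiξ)² = -(2πξ)²`. -/
def expIDSq (s : ℝ) (u : L2R) : L2R :=
  𝓕⁻ (expIXSq (-(s * (2 * Real.pi) ^ 2)) (𝓕 u))

/-- `α_λ = ½ √(|λ⁻¹ - 1| λ⁻¹)`. -/
def dilAlpha (lam : ℝ) : ℝ := 1 / 2 * Real.sqrt (|lam⁻¹ - 1| * lam⁻¹)

/-- `β_λ = ½ √|1 - λ|`. -/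
def dilBeta (lam : ℝ) : ℝ := 1 / 2 * Real.sqrt |1 - lam|

/-- `ε_λ = 1` if `λ ≤ 1`, and `ε_λ = -1` otherwise. -/
def dilEps (lam : ℝ) : ℝ := if lam ≤ 1 then 1 else -1

end

noncomputable section

open Complex (I)

/-! Both sides are bounded linear operators in `u`, so it suffices to compare them on the modulated
Gaussians `exp(-πx² + 2πitx)`, whose span is dense (`dense_span_gaussLp`). The family `exp(-πAx² +
2πcx)`, `Re A > 0`, is stable up to scalars: `e^{iax²}` adds `-ia/π` to `A`, and `e^{is∂ₓ²}` adds
`4πis` to `A⁻¹`. Composing the four steps is then algebra resting on `β = λα` and `4εβ² = 1 - λ`.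
The only analytic subtlety is the branch of the accumulated square roots, fixed by staying in the
right half plane. -/

theorem MeasureTheory.Lp.fourier_toLp_eq_of_integrable {f : ℝ → ℂ} (hf : Integrable f)
    (hf2 : MemLp f 2 volume) (hg : MemLp (𝓕 f) 2 volume) :
    𝓕 (hf2.toLp f : Lp ℂ 2 (volume : Measure ℝ)) = hg.toLp (𝓕 f) := by
  -- `L²` embeds in tempered distributions, so it suffices to test against Schwartz `φ` and move the
  -- transform onto `φ` by Fubini.
  have hinj : Function.Injective (Lp.toTemperedDistributionCLM ℂ (volume : Measure ℝ) 2) :=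
    LinearMap.ker_eq_bot.mp Lp.ker_toTemperedDistributionCLM_eq_bot
  apply hinj
  simp only [Lp.toTemperedDistributionCLM_apply]
  rw [← Lp.fourier_toTemperedDistribution_eq]
  ext φ
  rw [TemperedDistribution.fourier_apply, Lp.toTemperedDistribution_apply,
    Lp.toTemperedDistribution_apply]
  have h1 : ∫ x, (𝓕 φ) x • (hf2.toLp f : Lp ℂ 2 (volume : Measure ℝ)) x
      = ∫ x, (𝓕 (φ : ℝ → ℂ)) x • f x := by
    refine integral_congr_ae ?_
    filter_upwards [hf2.coeFn_toLp] with x hx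
    rw [hx, SchwartzMap.fourier_coe]
  have h2 : ∫ x, φ x • (hg.toLp (𝓕 f) : Lp ℂ 2 (volume : Measure ℝ)) x
      = ∫ x, φ x • (𝓕 f) x := by
    refine integral_congr_ae ?_
    filter_upwards [hg.coeFn_toLp] with x hx
    rw [hx]
  rw [h1, h2]
  simpa using! (VectorFourier.integral_fourierIntegral_smul_eq_flip (L := innerₗ ℝ)
    Real.continuous_fourierChar continuous_inner φ.integrable hf)

/-! ### Complex Gaussians and their Fourier transforms -/

/-- The complex Gaussian `x ↦ exp(-π A x² + 2π c x)`. -/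
def gaussFun (A c : ℂ) (x : ℝ) : ℂ :=
  Complex.exp (-Real.pi * A * (x : ℂ) ^ 2 + 2 * Real.pi * c * x)

theorem continuous_gaussFun (A c : ℂ) : Continuous (gaussFun A c) := by
  unfold gaussFun; fun_prop

theorem integrable_gaussFun {A : ℂ} (hA : 0 < A.re) (c : ℂ) : Integrable (gaussFun A c) := by
  have h : 0 < ((Real.pi : ℂ) * A).re := by
    rw [Complex.re_ofReal_mul]; exact mul_pos Real.pi_pos hA
  refine (integrable_cexp_quadratic h (2 * Real.pi * c) 0).congr
    (Filter.Eventually.of_forall fun x => ?_)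
  simp [gaussFun]

theorem memLp_gaussFun {A : ℂ} (hA : 0 < A.re) (c : ℂ) : MemLp (gaussFun A c) 2 volume := by
  rw [memLp_two_iff_integrable_sq_norm (continuous_gaussFun A c).aestronglyMeasurable]
  have h : 0 < (2 * A).re := by simpa using hA
  refine (integrable_gaussFun h (2 * c)).norm.congr (Filter.Eventually.of_forall fun x => ?_)
  simp only [gaussFun]
  rw [← norm_pow, ← Complex.exp_nat_mul]
  congr 2
  push_cast
  ring

/-- The complex Gaussian `x ↦ exp(-π A x² + 2π c x)` as an element of `L²(ℝ)`. -/
def gaussLp (A c : ℂ) (hA : 0 < A.re) : L2R := (memLp_gaussFun hA c).toLp (gaussFun A c)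

theorem coeFn_gaussLp {A : ℂ} (hA : 0 < A.re) (c : ℂ) :
    (gaussLp A c hA : ℝ → ℂ) =ᵐ[volume] gaussFun A c :=
  (memLp_gaussFun hA c).coeFn_toLp

theorem gaussLp_congr {A B c d : ℂ} (hA : 0 < A.re) (hB : 0 < B.re) (h : A = B) (h' : c = d) :
    gaussLp A c hA = gaussLp B d hB := by
  subst h h'; rfl

theorem Complex.re_inv_pos {z : ℂ} (hz : 0 < z.re) : 0 < z⁻¹.re := by
  rw [Complex.inv_re]
  exact div_pos hz (Complex.normSq_pos.mpr (Complex.ne_zero_of_re_pos hz))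

theorem fourier_gaussFun {A : ℂ} (hA : 0 < A.re) (c : ℂ) :
    𝓕 (gaussFun A c) = ((A ^ (1 / 2 : ℂ))⁻¹ * Complex.exp (Real.pi * c ^ 2 / A)) •
      gaussFun A⁻¹ (-I * c / A) := by
  have hA0 := Complex.ne_zero_of_re_pos hA
  unfold gaussFun
  rw [fourier_gaussian_pi' hA c]
  funext t
  simp only [Pi.smul_apply, smul_eq_mul, one_div, mul_assoc]
  rw [← Complex.exp_add]
  congr 2
  field_simp
  linear_combination (-c ^ 2) * Complex.I_sq

theorem fourier_gaussLp {A : ℂ} (hA : 0 < A.re) (c : ℂ) :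
    𝓕 (gaussLp A c hA) = ((A ^ (1 / 2 : ℂ))⁻¹ * Complex.exp (Real.pi * c ^ 2 / A)) •
      gaussLp A⁻¹ (-I * c / A) (Complex.re_inv_pos hA) := by
  have hm := (memLp_gaussFun (Complex.re_inv_pos hA) (-I * c / A)).const_smul
    ((A ^ (1 / 2 : ℂ))⁻¹ * Complex.exp (Real.pi * c ^ 2 / A))
  have hm' := hm
  rw [← fourier_gaussFun hA c] at hm'
  unfold gaussLp
  rw [Lp.fourier_toLp_eq_of_integrable (integrable_gaussFun hA c) _ hm', ← MemLp.toLp_const_smul]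
  exact MemLp.toLp_congr hm' hm (Filter.EventuallyEq.of_eq (fourier_gaussFun hA c))

theorem Complex.arg_ne_pi_of_re_pos {z : ℂ} (hz : 0 < z.re) : z.arg ≠ Real.pi := fun h =>
  absurd (Complex.arg_eq_pi_iff.mp h).1 (not_lt.mpr hz.le)

theorem fourierInv_gaussLp {B : ℂ} (hB : 0 < B.re) (d : ℂ) :
    𝓕⁻ (gaussLp B d hB) = ((B ^ (1 / 2 : ℂ))⁻¹ * Complex.exp (Real.pi * d ^ 2 / B)) •
      gaussLp B⁻¹ (I * d / B) (Complex.re_inv_pos hB) := by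
  have hB0 := Complex.ne_zero_of_re_pos hB
  have hI := Complex.I_sq
  have hr : B ^ (1 / 2 : ℂ) ≠ 0 := by simp [Complex.cpow_eq_zero_iff, hB0]
  -- The candidate inverse is checked by transforming it forward.
  have h : gaussLp B d hB = 𝓕 (((B ^ (1 / 2 : ℂ))⁻¹ * Complex.exp (Real.pi * d ^ 2 / B)) •
      gaussLp B⁻¹ (I * d / B) (Complex.re_inv_pos hB)) := by
    rw [FourierTransform.fourier_smul, fourier_gaussLp, smul_smul,
      Complex.inv_cpow _ _ (Complex.arg_ne_pi_of_re_pos hB), inv_inv]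
    have hexp : (B ^ (1 / 2 : ℂ))⁻¹ * Complex.exp (Real.pi * d ^ 2 / B) *
        (B ^ (1 / 2 : ℂ) * Complex.exp (Real.pi * (I * d / B) ^ 2 / B⁻¹)) = 1 := by
      have : (B ^ (1 / 2 : ℂ))⁻¹ * Complex.exp (Real.pi * d ^ 2 / B) *
          (B ^ (1 / 2 : ℂ) * Complex.exp (Real.pi * (I * d / B) ^ 2 / B⁻¹)) =
          ((B ^ (1 / 2 : ℂ))⁻¹ * B ^ (1 / 2 : ℂ)) * (Complex.exp (Real.pi * d ^ 2 / B) *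
          Complex.exp (Real.pi * (I * d / B) ^ 2 / B⁻¹)) := by ring
      rw [this, inv_mul_cancel₀ hr, ← Complex.exp_add, one_mul, Complex.exp_eq_one_iff]
      refine ⟨0, ?_⟩
      field_simp
      rw [hI]
      ring
    rw [hexp, one_smul]
    refine gaussLp_congr _ _ (inv_inv B).symm ?_
    field_simp
    rw [hI]
    ring
  rw [h, FourierTransform.fourierInv_fourier_eq]

/-! ### Action of the multipliers and propagators -/

theorem expIXSq_gaussLp {A : ℂ} (hA : 0 < A.re) (c : ℂ) (a : ℝ)
    {B : ℂ} (hB : 0 < B.re) (h : B = A - I * a / Real.pi) :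
    expIXSq a (gaussLp A c hA) = gaussLp B c hB := by
  subst h
  refine MemLp.toLp_congr _ _ ?_
  filter_upwards [coeFn_gaussLp hA c] with x hx
  rw [hx, gaussFun, gaussFun, ← Complex.exp_add]
  congr 1
  have : (Real.pi : ℂ) ≠ 0 := by exact_mod_cast Real.pi_ne_zero
  field_simp
  ring

theorem coeFn_expIXSq (a : ℝ) (u : L2R) : (expIXSq a u : ℝ → ℂ) =ᵐ[volume]
    fun x : ℝ => Complex.exp (I * (a : ℂ) * (x : ℂ) ^ 2) * u x :=
  (memLp_expISq_mul a u).coeFn_toLp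

theorem norm_expIXSq (a : ℝ) (u : L2R) : ‖expIXSq a u‖ = ‖u‖ := by
  have hae : ∀ᵐ x, ‖expIXSq a u x‖ = ‖u x‖ := by
    filter_upwards [coeFn_expIXSq a u] with x hx
    have h : I * (a : ℂ) * (x : ℂ) ^ 2 = ((a * x ^ 2 : ℝ) : ℂ) * I := by
      push_cast; ring
    rw [hx, norm_mul, h, Complex.norm_exp_ofReal_mul_I, one_mul]
  exact le_antisymm (Lp.norm_le_norm_of_ae_le (hae.mono fun _ h => h.le))
    (Lp.norm_le_norm_of_ae_le (hae.mono fun _ h => h.ge))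

/-- The operator `e^{i a x²}` as a linear isometry of `L²(ℝ)`. -/
def expIXSqLI (a : ℝ) : L2R →ₗᵢ[ℂ] L2R where
  toFun := expIXSq a
  map_add' u v := by
    ext1
    filter_upwards [coeFn_expIXSq a (u + v), coeFn_expIXSq a u, coeFn_expIXSq a v,
      Lp.coeFn_add u v, Lp.coeFn_add (expIXSq a u) (expIXSq a v)] with x h1 h2 h3 h4 h5
    rw [h1, h5, Pi.add_apply, h2, h3, h4, Pi.add_apply, mul_add]
  map_smul' k u := by
    ext1
    filter_upwards [coeFn_expIXSq a (k • u), coeFn_expIXSq a u,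
      Lp.coeFn_smul k u, Lp.coeFn_smul k (expIXSq a u)] with x h1 h2 h3 h4
    simp only [RingHom.id_apply]
    rw [h1, h4, Pi.smul_apply, h2, h3, Pi.smul_apply, smul_eq_mul, smul_eq_mul]
    ring
  norm_map' := norm_expIXSq a

/-- The Schrödinger propagator `e^{i s ∂ₓ²}` as a linear isometry of `L²(ℝ)`. -/
def expIDSqLI (s : ℝ) : L2R →ₗᵢ[ℂ] L2R :=
  ((Lp.fourierTransformₗᵢ ℝ ℂ).symm.toLinearIsometry.comp
    (expIXSqLI (-(s * (2 * Real.pi) ^ 2)))).comp (Lp.fourierTransformₗᵢ ℝ ℂ).toLinearIsometry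

theorem expIXSq_smul (a : ℝ) (k : ℂ) (u : L2R) : expIXSq a (k • u) = k • expIXSq a u :=
  (expIXSqLI a).map_smul k u

theorem expIDSq_smul (s : ℝ) (k : ℂ) (u : L2R) : expIDSq s (k • u) = k • expIDSq s u :=
  (expIDSqLI s).map_smul k u

/-- On the Fourier side the Gaussian has width parameter `A⁻¹`, which the symbol shifts to `B`; the
two transforms contribute `πc²/A` and `-πc²/(A²B)` to the exponent. -/
theorem expIDSq_gaussLp {A : ℂ} (hA : 0 < A.re) (c : ℂ) (s : ℝ)
    {B : ℂ} (hB : 0 < B.re) (h : B = A⁻¹ + 4 * Real.pi * I * s) :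
    expIDSq s (gaussLp A c hA) =
      ((A ^ (1 / 2 : ℂ) * B ^ (1 / 2 : ℂ))⁻¹ *
        Complex.exp (Real.pi * c ^ 2 * (A⁻¹ - (A ^ 2 * B)⁻¹))) •
      gaussLp B⁻¹ (c / (A * B)) (Complex.re_inv_pos hB) := by
  have hA0 := Complex.ne_zero_of_re_pos hA
  have hB0 := Complex.ne_zero_of_re_pos hB
  have hpi : (Real.pi : ℂ) ≠ 0 := by exact_mod_cast Real.pi_ne_zero
  rw [expIDSq, fourier_gaussLp, expIXSq_smul, expIXSq_gaussLp (B := B) _ _ _ hB,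
    FourierTransform.fourierInv_smul, fourierInv_gaussLp, smul_smul]
  · congr 1
    · rw [mul_inv, mul_mul_mul_comm, ← Complex.exp_add]
      congr 2
      field_simp
      rw [Complex.I_sq]
      ring
    · refine gaussLp_congr _ _ rfl ?_
      field_simp
      rw [Complex.I_sq]
      ring
  · rw [h]
    push_cast
    field_simp
    ring

/-! ### Density of modulated Gaussians -/

/-- The Gaussians of unit width with arbitrary modulation span a dense subspace of `L²(ℝ)`. -/
theorem dense_span_gaussLp :
    Dense (Submodule.span ℂ (Set.range fun t : ℝ =>
      gaussLp 1 (I * t) (by simp)) : Set L2R) := by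
  rw [Submodule.dense_iff_topologicalClosure_eq_top, Submodule.topologicalClosure_eq_top_iff,
    Submodule.eq_bot_iff]
  intro v hv
  have hone : 0 < (1 : ℂ).re := by simp
  set w : ℝ → ℂ := fun x => v x * gaussFun 1 0 x with hw
  have hwint : Integrable w := (Lp.memLp v).integrable_mul (memLp_gaussFun hone 0)
  -- Orthogonality to the Gaussian of modulation `t` says exactly that the transform of `w` vanishes
  -- at `t`.
  have hF : 𝓕 w = 0 := by
    funext t
    have h0 := Submodule.inner_right_of_mem_orthogonal
      (Submodule.subset_span (Set.mem_range_self t)) hv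
    rw [L2.inner_def] at h0
    rw [Real.fourier_eq', Pi.zero_apply, ← h0]
    refine integral_congr_ae ?_
    filter_upwards [coeFn_gaussLp hone (I * t)] with x hx
    rw [hx, RCLike.inner_apply (𝕜 := ℂ), hw]
    simp only [gaussFun, smul_eq_mul]
    rw [← Complex.exp_conj, mul_left_comm, ← Complex.exp_add]
    congr 2
    simp [Complex.conj_ofNat]
    ring
  have hw0 : ∀ᵐ x, w x = 0 := by
    refine ae_eq_zero_of_integral_contDiff_smul_eq_zero hwint.locallyIntegrable fun g hg hgs => ?_
    have hgs' : HasCompactSupport (fun x => (g x : ℂ)) :=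
      hgs.comp_left (g := fun r : ℝ => (r : ℂ)) (by simp)
    -- Each test function `g` is the transform of a Schwartz `φ`, so `∫ g w = ∫ φ 𝓕w = 0`.
    let ψ : SchwartzMap ℝ ℂ := hgs'.toSchwartzMap (Complex.ofRealCLM.contDiff.comp hg)
    let φ : SchwartzMap ℝ ℂ := 𝓕⁻ ψ
    have hφ : 𝓕 (φ : ℝ → ℂ) = fun x => (g x : ℂ) := by
      rw [← SchwartzMap.fourier_coe, FourierTransform.fourier_fourierInv_eq]
      rfl
    have key : ∫ ξ, (𝓕 (φ : ℝ → ℂ)) ξ • w ξ = ∫ x, φ x • (𝓕 w) x := by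
      simpa using! (VectorFourier.integral_fourierIntegral_smul_eq_flip (L := innerₗ ℝ)
        Real.continuous_fourierChar continuous_inner φ.integrable hwint)
    rw [hφ, hF] at key
    simpa using key
  refine (Lp.eq_zero_iff_ae_eq_zero).mpr ?_
  filter_upwards [hw0] with x hx
  exact (mul_eq_zero.mp hx).resolve_right (Complex.exp_ne_zero _)

/-! ### The dilation operator -/

theorem quasiMeasurePreserving_const_mul {lam : ℝ} (hlam : lam ≠ 0) :
    Measure.QuasiMeasurePreserving (fun x : ℝ => lam * x) volume volume := by
  refine ⟨by fun_prop, ?_⟩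
  rw [Real.map_volume_mul_left hlam]
  exact Measure.smul_absolutelyContinuous

theorem eLpNorm_comp_const_mul {lam : ℝ} (hlam : lam ≠ 0) {u : ℝ → ℂ}
    (hu : AEStronglyMeasurable u volume) :
    eLpNorm (fun x : ℝ => u (lam * x)) 2 volume =
      ENNReal.ofReal |lam⁻¹| ^ (1 / 2 : ℝ) * eLpNorm u 2 volume := by
  have h := Real.map_volume_mul_left hlam
  have hu' : AEStronglyMeasurable u (Measure.map (fun x : ℝ => lam * x) volume) := by
    rw [h]; exact hu.smul_measure _
  have h2 := eLpNorm_map_measure (p := 2) hu' (by fun_prop : AEMeasurable (fun x : ℝ => lam * x))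
  rw [h, eLpNorm_smul_measure_of_ne_top (by simp)] at h2
  rw [show (fun x : ℝ => u (lam * x)) = u ∘ (fun x => lam * x) from rfl, ← h2]
  simp

theorem memLp_comp_const_mul {lam : ℝ} (hlam : lam ≠ 0) (u : L2R) :
    MemLp (fun x : ℝ => u (lam * x)) 2 volume := by
  refine ⟨(Lp.aestronglyMeasurable u).comp_quasiMeasurePreserving
    (quasiMeasurePreserving_const_mul hlam), ?_⟩
  rw [eLpNorm_comp_const_mul hlam (Lp.aestronglyMeasurable u)]
  exact ENNReal.mul_lt_top (ENNReal.rpow_lt_top_of_nonneg (by norm_num) ENNReal.ofReal_ne_top)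
    (Lp.memLp u).2

/-- The dilation `u ↦ u(lam ·)` as a continuous linear operator on `L²(ℝ)`. -/
def dilationCLM {lam : ℝ} (hlam : lam ≠ 0) : L2R →L[ℂ] L2R :=
  LinearMap.mkContinuous
    { toFun := fun u => (memLp_comp_const_mul hlam u).toLp _
      map_add' := fun u v => by
        rw [← MemLp.toLp_add]
        exact MemLp.toLp_congr _ _
          ((quasiMeasurePreserving_const_mul hlam).ae_eq_comp (Lp.coeFn_add u v))
      map_smul' := fun k u => by
        rw [RingHom.id_apply, ← MemLp.toLp_const_smul]
        exact MemLp.toLp_congr _ _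
          ((quasiMeasurePreserving_const_mul hlam).ae_eq_comp (Lp.coeFn_smul k u)) }
    (ENNReal.ofReal |lam⁻¹| ^ (1 / 2 : ℝ)).toReal
    (fun u => by
      change ‖(memLp_comp_const_mul hlam u).toLp _‖ ≤ _
      rw [Lp.norm_toLp, eLpNorm_comp_const_mul hlam (Lp.aestronglyMeasurable u),
        ENNReal.toReal_mul, Lp.norm_def])

theorem coeFn_dilationCLM {lam : ℝ} (hlam : lam ≠ 0) (u : L2R) :
    (dilationCLM hlam u : ℝ → ℂ) =ᵐ[volume] fun x : ℝ => u (lam * x) :=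
  (memLp_comp_const_mul hlam u).coeFn_toLp

theorem dilationCLM_gaussLp {lam : ℝ} (hlam : lam ≠ 0) {A : ℂ} (hA : 0 < A.re) (c : ℂ)
    {B d : ℂ} (hB : 0 < B.re) (hAB : B = lam ^ 2 * A) (hcd : d = lam * c) :
    dilationCLM hlam (gaussLp A c hA) = gaussLp B d hB := by
  ext1
  filter_upwards [coeFn_dilationCLM hlam (gaussLp A c hA), coeFn_gaussLp hB d,
    (quasiMeasurePreserving_const_mul hlam).ae_eq_comp (coeFn_gaussLp hA c)] with x h1 h2 h3
  simp only [Function.comp_apply] at h3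
  rw [h1, h2, h3, gaussFun, gaussFun, hAB, hcd]
  congr 1
  push_cast
  ring

/-! ### Constants and branches of square roots -/

theorem dilBeta_eq {lam : ℝ} (hlam : 0 < lam) : dilBeta lam = lam * dilAlpha lam := by
  have h : |lam⁻¹ - 1| * lam⁻¹ = |1 - lam| / lam ^ 2 := by
    rw [show lam⁻¹ - 1 = (1 - lam) * lam⁻¹ by field_simp, abs_mul, abs_of_pos (inv_pos.mpr hlam)]
    field_simp
  rw [dilBeta, dilAlpha, h, Real.sqrt_div (abs_nonneg _), Real.sqrt_sq hlam.le]
  field_simp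

/-- The sign `ε` undoes the absolute value, so both cases of `λ` are treated at once. -/
theorem four_mul_dilEps_mul_dilBeta_sq (lam : ℝ) :
    4 * dilEps lam * dilBeta lam ^ 2 = 1 - lam := by
  rw [dilBeta, mul_pow, Real.sq_sqrt (abs_nonneg _), dilEps]
  split_ifs with h
  · rw [abs_of_nonneg (by linarith)]; ring
  · rw [abs_of_neg (by linarith)]; ring

/-- Each principal root has argument in `(-π/4, π/4)`. -/
theorem Complex.re_sqrt_mul_sqrt_pos {z w : ℂ} (hz : 0 < z.re) (hw : 0 < w.re) :
    0 < (z ^ (1 / 2 : ℂ) * w ^ (1 / 2 : ℂ)).re := by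
  have hz0 := Complex.ne_zero_of_re_pos hz
  have hw0 := Complex.ne_zero_of_re_pos hw
  rw [Complex.cpow_def_of_ne_zero hz0, Complex.cpow_def_of_ne_zero hw0, ← Complex.exp_add,
    Complex.exp_re]
  have h1 := abs_lt.mp (Complex.abs_arg_lt_pi_div_two_iff.mpr (Or.inl hz))
  have h2 := abs_lt.mp (Complex.abs_arg_lt_pi_div_two_iff.mpr (Or.inl hw))
  have him : (Complex.log z * (1 / 2) + Complex.log w * (1 / 2)).im = (z.arg + w.arg) / 2 := by
    rw [show Complex.log z * (1 / 2) + Complex.log w * (1 / 2) =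
      ((1 / 2 : ℝ) : ℂ) * (Complex.log z + Complex.log w) by push_cast; ring,
      Complex.im_ofReal_mul, Complex.add_im, Complex.log_im, Complex.log_im]
    ring
  rw [him]
  exact mul_pos (Real.exp_pos _) (Real.cos_pos_of_mem_Ioo ⟨by linarith [h1.1, h2.1],
    by linarith [h1.2, h2.2]⟩)

theorem Complex.cpow_half_sq (z : ℂ) : (z ^ (1 / 2 : ℂ)) ^ 2 = z := by
  rw [← Complex.cpow_nat_mul]; simp

/-- If the product of four numbers in the right half plane is a positive real `r ^ 2`, the
product of their principal square roots is `r`. -/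
theorem Complex.sqrt_mul_sqrt_mul_sqrt_mul_sqrt_eq {a b c d : ℂ} (ha : 0 < a.re) (hb : 0 < b.re)
    (hc : 0 < c.re) (hd : 0 < d.re) {r : ℝ} (hr : 0 < r) (h : a * b * (c * d) = (r : ℂ) ^ 2) :
    a ^ (1 / 2 : ℂ) * b ^ (1 / 2 : ℂ) * (c ^ (1 / 2 : ℂ) * d ^ (1 / 2 : ℂ)) = r := by
  have hp := Complex.re_sqrt_mul_sqrt_pos ha hb
  have hq := Complex.re_sqrt_mul_sqrt_pos hc hd
  have hsq : (a ^ (1 / 2 : ℂ) * b ^ (1 / 2 : ℂ) * (c ^ (1 / 2 : ℂ) * d ^ (1 / 2 : ℂ))) ^ 2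
      = (r : ℂ) ^ 2 := by
    simp only [mul_pow, Complex.cpow_half_sq]; exact h
  refine (sq_eq_sq_iff_eq_or_eq_neg.mp hsq).resolve_right fun hneg => ?_
  set p := a ^ (1 / 2 : ℂ) * b ^ (1 / 2 : ℂ)
  set q := c ^ (1 / 2 : ℂ) * d ^ (1 / 2 : ℂ)
  have hre := congrArg Complex.re hneg
  have him := congrArg Complex.im hneg
  simp only [Complex.mul_re, Complex.mul_im, Complex.neg_re, Complex.neg_im, Complex.ofReal_re,
    Complex.ofReal_im, neg_zero] at hre him
  -- Since `pq` is real, its real part is `p.re (q.re + q.im²/q.re) > 0`, which excludes `-r`.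
  have h3 : p.im = -(p.re * q.im) / q.re := by field_simp; linarith
  rw [h3] at hre
  have h4 : p.re * q.re - -(p.re * q.im) / q.re * q.im =
      p.re * q.re + p.re * q.im ^ 2 / q.re := by ring
  rw [h4] at hre
  have : 0 < p.re * q.re + p.re * q.im ^ 2 / q.re := by positivity
  linarith

/-! ### The factorization on Gaussians -/

theorem dilation_factorization_gaussLp {lam : ℝ} (hlam : 0 < lam) (c : ℂ) :
    dilationCLM hlam.ne' (gaussLp 1 c (by simp)) =
      (((lam ^ (-(1 / 2) : ℝ) : ℝ) : ℂ) •
        expIDSq (-(dilEps lam * dilAlpha lam))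
          (expIXSq (-dilBeta lam)
            (expIDSq (dilEps lam * dilBeta lam)
              (expIXSq (dilAlpha lam) (gaussLp 1 c (by simp)))))) := by
  have hβ := dilBeta_eq hlam
  have hε := four_mul_dilEps_mul_dilBeta_sq lam
  rw [hβ] at hε ⊢
  generalize dilAlpha lam = α at *
  generalize dilEps lam = ε at *
  clear hβ
  have hl : (lam : ℂ) ≠ 0 := by exact_mod_cast hlam.ne'
  have hpi : (Real.pi : ℂ) ≠ 0 := by exact_mod_cast Real.pi_ne_zero
  have hε' : 4 * (ε : ℂ) * (lam * α) ^ 2 = 1 - lam := by exact_mod_cast congrArg Complex.ofReal hε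
  have hI := Complex.I_sq
  -- The width parameters after the four successive operators are `A`, `B⁻¹`, `C`, `D⁻¹`.
  obtain ⟨A, hAdef⟩ : ∃ A : ℂ, A = 1 - I * α / Real.pi := ⟨_, rfl⟩
  have hA : 0 < A.re := by
    rw [hAdef, show I * (α : ℂ) / Real.pi = ((α / Real.pi : ℝ) : ℂ) * I by push_cast; ring]
    simp
  have hA0 := Complex.ne_zero_of_re_pos hA
  obtain ⟨B, hBdef⟩ : ∃ B : ℂ, B = A⁻¹ + 4 * Real.pi * I * ((ε * (lam * α) : ℝ) : ℂ) := ⟨_, rfl⟩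
  have hB : 0 < B.re := by
    rw [hBdef, show 4 * (Real.pi : ℂ) * I * ((ε * (lam * α) : ℝ) : ℂ) =
      ((4 * Real.pi * (ε * (lam * α)) : ℝ) : ℂ) * I by push_cast; ring]
    simpa using Complex.re_inv_pos hA
  have hB0 := Complex.ne_zero_of_re_pos hB
  obtain ⟨C, hCdef⟩ : ∃ C : ℂ, C = B⁻¹ - I * ((-(lam * α) : ℝ) : ℂ) / Real.pi := ⟨_, rfl⟩
  have hC : 0 < C.re := by
    rw [hCdef, show I * ((-(lam * α) : ℝ) : ℂ) / Real.pi =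
      ((-(lam * α) / Real.pi : ℝ) : ℂ) * I by push_cast; ring]
    simpa using Complex.re_inv_pos hB
  have hC0 := Complex.ne_zero_of_re_pos hC
  obtain ⟨D, hDdef⟩ : ∃ D : ℂ, D = C⁻¹ + 4 * Real.pi * I * ((-(ε * α) : ℝ) : ℂ) := ⟨_, rfl⟩
  have hD : 0 < D.re := by
    rw [hDdef, show 4 * (Real.pi : ℂ) * I * ((-(ε * α) : ℝ) : ℂ) =
      ((4 * Real.pi * -(ε * α) : ℝ) : ℂ) * I by push_cast; ring]
    simpa using Complex.re_inv_pos hC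
  have hD0 := Complex.ne_zero_of_re_pos hD
  have hAB : A * B = (lam : ℂ)⁻¹ + 4 * Real.pi * I * (ε * (lam * α)) := by
    have : A * B = 1 + 4 * Real.pi * I * (ε * (lam * α)) * A := by
      rw [hBdef]; push_cast; field_simp
    rw [this, hAdef]
    field_simp
    linear_combination (-4 * (lam : ℂ) ^ 2 * α ^ 2 * ε) * hI + hε'
  have hABC : A * B * C = lam := by
    have : A * B * C = A + (A * B) * (I * (lam * α) / Real.pi) := by
      rw [hCdef]; push_cast; field_simp; ring
    rw [this, hAB, hAdef]
    field_simp
    linear_combination (4 * (lam : ℂ) ^ 2 * α ^ 2 * ε * Real.pi) * hI - Real.pi * hε'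
  have hCinv : C⁻¹ = A * B / lam := by
    rw [← hABC]; field_simp
  have hDval : D = ((lam : ℂ) ^ 2)⁻¹ := by
    rw [hDdef, hCinv, hAB]; push_cast; field_simp; ring
  have hABCD : A * B * (C * D) = (lam : ℂ)⁻¹ := by
    rw [← mul_assoc, hABC, hDval]; field_simp
  -- Total coefficient of `πc²` in the exponents from the two propagators.
  have hexp : A⁻¹ - (A ^ 2 * B)⁻¹ + ((A * B) ^ 2)⁻¹ * (C⁻¹ - (C ^ 2 * D)⁻¹) = 0 := by
    have hB' : B = A⁻¹ + 4 * Real.pi * I * (ε * (lam * α)) := by rw [hBdef]; push_cast; ring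
    have h1 : A⁻¹ - (A ^ 2 * B)⁻¹ = 4 * Real.pi * I * (ε * (lam * α)) / (A * B) := by
      rw [show (4 : ℂ) * Real.pi * I * (ε * (lam * α)) = B - A⁻¹ by rw [hB']; ring]
      field_simp
    have h2 : ((A * B) ^ 2)⁻¹ * (C⁻¹ - (C ^ 2 * D)⁻¹) = (lam : ℂ)⁻¹ / (A * B) - 1 := by
      have : (C ^ 2 * D)⁻¹ = (A * B) ^ 2 := by
        rw [mul_inv, ← inv_pow, hCinv, hDval]; field_simp
      rw [this, hCinv]; field_simp
    have hABne : A * B ≠ 0 := mul_ne_zero hA0 hB0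
    rw [h1, h2, ← add_sub_assoc, ← add_div, add_comm _ ((lam : ℂ)⁻¹), ← hAB,
      div_self hABne, sub_self]
  have hs : 0 < lam ^ (-(1 / 2) : ℝ) := Real.rpow_pos_of_pos hlam _
  have hs2 : ((lam ^ (-(1 / 2) : ℝ) : ℝ) : ℂ) ^ 2 = (lam : ℂ)⁻¹ := by
    rw [← Complex.ofReal_pow, ← Real.rpow_natCast, ← Real.rpow_mul hlam.le]
    norm_num [Real.rpow_neg_one]
  have hroot := Complex.sqrt_mul_sqrt_mul_sqrt_mul_sqrt_eq hA hB hC hD hs (hABCD.trans hs2.symm)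
  rw [expIXSq_gaussLp _ _ _ hA hAdef, expIDSq_gaussLp hA _ _ hB hBdef, expIXSq_smul,
    expIXSq_gaussLp _ _ _ hC hCdef, expIDSq_smul, expIDSq_gaussLp hC _ _ hD hDdef,
    smul_smul, smul_smul, mul_assoc, dilationCLM_gaussLp hlam.ne' _ _ (Complex.re_inv_pos hD) (d := lam * c)
      (by rw [hDval]; simp) rfl]
  have hscal : ((lam ^ (-(1 / 2) : ℝ) : ℝ) : ℂ) *
      ((A ^ (1 / 2 : ℂ) * B ^ (1 / 2 : ℂ))⁻¹ *
        Complex.exp (Real.pi * c ^ 2 * (A⁻¹ - (A ^ 2 * B)⁻¹)) *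
      ((C ^ (1 / 2 : ℂ) * D ^ (1 / 2 : ℂ))⁻¹ *
        Complex.exp (Real.pi * (c / (A * B)) ^ 2 * (C⁻¹ - (C ^ 2 * D)⁻¹)))) = 1 := by
    rw [mul_mul_mul_comm, ← mul_inv, hroot, ← Complex.exp_add,
      show (Real.pi : ℂ) * c ^ 2 * (A⁻¹ - (A ^ 2 * B)⁻¹) +
        Real.pi * (c / (A * B)) ^ 2 * (C⁻¹ - (C ^ 2 * D)⁻¹) = Real.pi * c ^ 2 *
        (A⁻¹ - (A ^ 2 * B)⁻¹ + ((A * B) ^ 2)⁻¹ * (C⁻¹ - (C ^ 2 * D)⁻¹)) by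
          rw [div_pow]; ring,
      hexp, mul_zero, Complex.exp_zero, mul_one, mul_inv_cancel₀]
    exact_mod_cast hs.ne'
  rw [hscal, one_smul]
  refine gaussLp_congr _ _ rfl ?_
  rw [div_div, hABCD]
  field_simp

end

theorem mainTheorem8 (lam : ℝ) (hlam : 0 < lam) (u : L2R) :
    (fun x : ℝ => u (lam * x)) =ᵐ[volume]
      ((((lam ^ (-(1 / 2) : ℝ) : ℝ) : ℂ) •
        expIDSq (-(dilEps lam * dilAlpha lam))
          (expIXSq (-dilBeta lam)
            (expIDSq (dilEps lam * dilBeta lam)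
              (expIXSq (dilAlpha lam) u))) : L2R) : ℝ → ℂ) := by
  -- The isometries unfold to the original operators, making the right-hand side continuous and
  -- linear.
  let T : L2R →L[ℂ] L2R := ((lam ^ (-(1 / 2) : ℝ) : ℝ) : ℂ) •
    ((expIDSqLI (-(dilEps lam * dilAlpha lam))).toContinuousLinearMap ∘L
      (expIXSqLI (-dilBeta lam)).toContinuousLinearMap ∘L
      (expIDSqLI (dilEps lam * dilBeta lam)).toContinuousLinearMap ∘L
      (expIXSqLI (dilAlpha lam)).toContinuousLinearMap)
  have hT : dilationCLM hlam.ne' = T := by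
    refine ContinuousLinearMap.ext_on dense_span_gaussLp ?_
    rintro _ ⟨t, rfl⟩
    exact dilation_factorization_gaussLp hlam _
  have h := coeFn_dilationCLM hlam.ne' u
  rw [hT] at h
  exact h.symm
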